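/- Let $\Gamma$ be a countable discrete group. For a group $G$, a $G$-space is a nonempty compact Hausdorff space on which $G$ acts by homeomorphisms; $\mathrm{Prob}(Y)$ is the set of regular Borel probability measures on $Y$ with the weak* topology. A $G$-space $Y$ is minimal if all its orbits are dense. It is a $G$-boundary if it is minimal and, for every $\nu\in\mathrm{Prob}(Y)$, the closure of $G\nu$ contains a point mass. For a $G$-space $X$, a $(G,X)$-boundary is a minimal $G$-space $Y$ with a continuous equivariant surjection $\varphi:Y\to X$ such that, for every $\nu\in\mathrm{Prob}(Y)$ with $\operatorname{supp}\nu\subseteq\varphi^{-1}(x)$ for some $x\in X$, the closure of $G\nu$ contains a point mass. The Furstenberg boundary $\partial_F G$ is the universal $G$-boundary, i.e. the $G$-boundary having every $G$-boundary as an image under a continuous equivariant surjection. The universal $(G,X)$-boundary $\partial_F(G,X)$ is the $(G,X)$-boundary having every $(G,X)$-boundary as an image under a continuous equivariant surjection over $X$. For a finite-index subgroup $\Lambda\le\Gamma$ with left transversal $T$, and a $\Lambda$-space $Y$, the induced $\Gamma$-space is $\tilde Y=\Gamma/\Lambda\times Y$ with the action $\gamma(t\Lambda,y)=(\gamma t\Lambda,\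 \alpha(\gamma,t\Lambda)^{-1}y)$ for $t\in T$, where $\alpha(\gamma,t\Lambda)$ is the unique $\lambda\in\Lambda$ with $\gamma t\lambda\in T$. 1. If $\Lambda\le\Gamma$ has finite index and $Y$ is a $\Lambda$-boundary, then $\tilde Y$, with the projection to $\Gamma/\Lambda$, is a $(\Gamma,\Gamma/\Lambda)$-boundary. 2. Conversely, let $X$ be a finite minimal $\Gamma$-space and $(Y,\varphi)$ a $(\Gamma,X)$-boundary. For every $x\in X$ the stabilizer $\Lambda=\Gamma_x$ has finite index in $\Gamma$, and $(Y,\varphi)$ is isomorphic to the induced $\Gamma$-space of some $\Lambda$-boundary, by an equivariant homeomorphism compatible with the identification $\Gamma/\Lambda\cong X$, $\gamma\Lambda\mapsto\gamma x$. 3. In particular, for a finite minimal $\Gamma$-space $X$ and every $x\in X$ with stabilizer $\Lambda=\Gamma_x$ (of finite index), $\partial_F(\Gamma,X)$ and $\partial_F\Lambda$ exist, and $\partial_F(\Gamma,X)$ is isomorphic, over $X\cong\Gamma/\Lambda$, to the induced $\Gamma$-space of $\partial_F\Lambda$. -/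

import Mathlib

open MeasureTheory Set Topology

universe u v w

/-! A `G`-space, for a discrete group `G`, is a nonempty compact Hausdorff space `Y` with
`[MulAction G Y] [ContinuousConstSMul G Y]`.  `Prob(Y)` is the set of regular Borel probability
measures on `Y`, with the weak-* topology. -/

section Boundaries

variable (G : Type u) [Group G]

/-- The translate `g ν` of a Borel probability measure, `(g ν)(E) = ν (g⁻¹ E)`. -/
noncomputable def translateProb {G : Type u} [Group G] {Y : Type v} [TopologicalSpace Y]
    [MulAction G Y] [ContinuousConstSMul G Y] [MeasurableSpace Y] [BorelSpace Y]
    (g : G) (ν : ProbabilityMeasure Y) : ProbabilityMeasure Y :=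
  ν.map (continuous_const_smul (T := Y) g).measurable.aemeasurable

/-- The weak-* closure of the orbit `G ν` contains a point mass. -/
def ContractsToPoint {Y : Type v} [TopologicalSpace Y]
    [MulAction G Y] [ContinuousConstSMul G Y] [MeasurableSpace Y] [BorelSpace Y]
    (ν : ProbabilityMeasure Y) : Prop :=
  ∃ y : Y, diracProba y ∈ closure (range fun g : G => translateProb g ν)

/-- A `G`-space is strongly proximal if every regular Borel probability measure on it can be
contracted to a point mass. -/
def IsStronglyProximal (Y : Type v) [TopologicalSpace Y]
    [MulAction G Y] [ContinuousConstSMul G Y] : Prop :=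
  ∀ [MeasurableSpace Y] [BorelSpace Y] (ν : ProbabilityMeasure Y),
    (ν : Measure Y).Regular → ContractsToPoint G ν

/-- A `G`-boundary: a (nonempty) minimal and strongly proximal `G`-space. -/
structure IsBoundary (Y : Type v) [TopologicalSpace Y] [CompactSpace Y] [T2Space Y]
    [MulAction G Y] [ContinuousConstSMul G Y] : Prop where
  nonempty : Nonempty Y
  minimal : MulAction.IsMinimal G Y
  stronglyProximal : IsStronglyProximal G Y

/-- A `G`-map: continuous and equivariant. -/
structure IsGMap {Y : Type v} {X : Type w} [TopologicalSpace Y] [TopologicalSpace X]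
    [MulAction G Y] [MulAction G X] (φ : Y → X) : Prop where
  continuous : Continuous φ
  map_smul : ∀ (g : G) (y : Y), φ (g • y) = g • φ y

/-- `(Y, φ)` is an extension of `X`: a surjective `G`-map. -/
structure IsExtension {Y : Type v} {X : Type w} [TopologicalSpace Y] [TopologicalSpace X]
    [MulAction G Y] [MulAction G X] (φ : Y → X) : Prop extends IsGMap G φ where
  surjective : Function.Surjective φ

/-- Strong proximality of `φ : Y → X`: every regular Borel probability measure whose support lies
in one fibre of `φ` can be contracted to a point mass. -/
def IsStronglyProximalOver {Y : Type v} {X : Type w} [TopologicalSpace Y]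
    [MulAction G Y] [ContinuousConstSMul G Y] (φ : Y → X) : Prop :=
  ∀ [MeasurableSpace Y] [BorelSpace Y] (ν : ProbabilityMeasure Y),
    (ν : Measure Y).Regular → ∀ x : X, (ν : Measure Y).support ⊆ φ ⁻¹' {x} →
      ContractsToPoint G ν

/-- `(Y, φ)` is a `(G, X)`-boundary: a minimal strongly proximal extension of `X`. -/
structure IsBoundaryOver {Y : Type v} {X : Type w} [TopologicalSpace Y] [CompactSpace Y]
    [T2Space Y] [MulAction G Y] [ContinuousConstSMul G Y] [TopologicalSpace X] [MulAction G X]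
    (φ : Y → X) : Prop where
  extension : IsExtension G φ
  minimal : MulAction.IsMinimal G Y
  stronglyProximal : IsStronglyProximalOver G φ

/-- `F` is (a model of) the Furstenberg boundary of `G`: a `G`-boundary of which every
`G`-boundary is an image. -/
structure IsFurstenbergBoundary (F : Type v) [TopologicalSpace F] [CompactSpace F] [T2Space F]
    [MulAction G F] [ContinuousConstSMul G F] : Prop where
  boundary : IsBoundary G F
  universal : ∀ (Y : Type v) [TopologicalSpace Y] [CompactSpace Y] [T2Space Y]
    [MulAction G Y] [ContinuousConstSMul G Y], IsBoundary G Y →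
      ∃ f : F → Y, IsExtension G f

/-- `(Z, π)` is (a model of) the universal `(G, X)`-boundary: a `(G, X)`-boundary of which every
`(G, X)`-boundary is an image, as an extension of `X`. -/
structure IsUniversalBoundaryOver {Z : Type v} {X : Type w} [TopologicalSpace Z] [CompactSpace Z]
    [T2Space Z] [MulAction G Z] [ContinuousConstSMul G Z] [TopologicalSpace X] [MulAction G X]
    (π : Z → X) : Prop where
  boundary : IsBoundaryOver G π
  universal : ∀ (Y : Type v) [TopologicalSpace Y] [CompactSpace Y] [T2Space Y]
    [MulAction G Y] [ContinuousConstSMul G Y] (φ : Y → X), IsBoundaryOver G φ →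
      ∃ f : Z → Y, IsExtension G f ∧ ∀ z, φ (f z) = π z

end Boundaries

section Induced

variable {Γ : Type u} [Group Γ] {Λ : Subgroup Γ} {T : Set Γ}

/-- The representative `t ∈ T` of a coset `q = t Λ`, for a left transversal `T` of `Λ`. -/
noncomputable def cosetRep (hT : Subgroup.IsComplement T (Λ : Set Γ)) (q : Γ ⧸ Λ) : Γ :=
  (hT.leftQuotientEquiv q : Γ)

theorem mk_cosetRep (hT : Subgroup.IsComplement T (Λ : Set Γ)) (q : Γ ⧸ Λ) :
    ((cosetRep hT q : Γ) : Γ ⧸ Λ) = q :=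
  hT.leftQuotientEquiv.symm_apply_apply q

/-- The cocycle `α : Γ × Γ/Λ → Λ`: for `t ∈ T`, `α(γ, tΛ)` is the `l ∈ Λ` with `γ t l ∈ T`, that
is `l = t⁻¹ γ⁻¹ t'` where `t' ∈ T` represents `γ t Λ`. -/
noncomputable def inducedCocycle (hT : Subgroup.IsComplement T (Λ : Set Γ)) (γ : Γ) (q : Γ ⧸ Λ) :
    Λ :=
  ⟨(cosetRep hT q)⁻¹ * γ⁻¹ * cosetRep hT (γ • q), by
    have h : ((γ * cosetRep hT q : Γ) : Γ ⧸ Λ) = ((cosetRep hT (γ • q) : Γ) : Γ ⧸ Λ) := by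
      rw [mk_cosetRep]
      conv_rhs => rw [← mk_cosetRep hT q]
      rfl
    have h2 := QuotientGroup.eq.1 h
    rwa [mul_inv_rev] at h2⟩

theorem inducedCocycle_spec (hT : Subgroup.IsComplement T (Λ : Set Γ)) (γ : Γ) (q : Γ ⧸ Λ) :
    γ * cosetRep hT q * (inducedCocycle hT γ q : Γ) ∈ T := by
  have : γ * cosetRep hT q * (inducedCocycle hT γ q : Γ) = cosetRep hT (γ • q) := by
    simp only [inducedCocycle]; group
  rw [this]
  exact (hT.leftQuotientEquiv (γ • q)).2

/-- The induced `Γ`-space of a `Λ`-space `Y` with respect to a left transversal `T`: the product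
`Γ/Λ × Y` with the twisted action below. -/
def InducedSpace (_hT : Subgroup.IsComplement T (Λ : Set Γ)) (Y : Type v) : Type (max u v) :=
  (Γ ⧸ Λ) × Y

namespace InducedSpace

variable {hT : Subgroup.IsComplement T (Λ : Set Γ)} {Y : Type v}

/-- The projection `Γ/Λ × Y → Γ/Λ`. -/
def toQuotient (p : InducedSpace hT Y) : Γ ⧸ Λ := p.1

instance [TopologicalSpace Γ] [TopologicalSpace Y] : TopologicalSpace (InducedSpace hT Y) :=
  inferInstanceAs (TopologicalSpace ((Γ ⧸ Λ) × Y))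

instance [TopologicalSpace Γ] [TopologicalSpace Y] [Λ.FiniteIndex] [CompactSpace Y] :
    CompactSpace (InducedSpace hT Y) :=
  inferInstanceAs (CompactSpace ((Γ ⧸ Λ) × Y))

instance [TopologicalSpace Γ] [DiscreteTopology Γ] [TopologicalSpace Y] [T2Space Y] :
    T2Space (InducedSpace hT Y) :=
  have : DiscreteTopology (Γ ⧸ Λ) := QuotientGroup.discreteTopology (isOpen_discrete _)
  inferInstanceAs (T2Space ((Γ ⧸ Λ) × Y))

/-- `γ (q, y) = (γ q, α(γ, q)⁻¹ y)`. -/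
noncomputable instance [MulAction Λ Y] : MulAction Γ (InducedSpace hT Y) where
  smul γ p := (γ • p.1, (inducedCocycle hT γ p.1)⁻¹ • p.2)
  one_smul := by
    rintro ⟨q, y⟩
    have h : inducedCocycle hT (1 : Γ) q = 1 := by
      apply Subtype.ext; simp [inducedCocycle]
    change ((1 : Γ) • q, (inducedCocycle hT (1 : Γ) q)⁻¹ • y) = (q, y)
    rw [h]; simp
  mul_smul := by
    rintro γ δ ⟨q, y⟩
    change ((γ * δ) • q, (inducedCocycle hT (γ * δ) q)⁻¹ • y) =
      (γ • δ • q, (inducedCocycle hT γ (δ • q))⁻¹ • (inducedCocycle hT δ q)⁻¹ • y)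
    have h : inducedCocycle hT (γ * δ) q = inducedCocycle hT δ q * inducedCocycle hT γ (δ • q) := by
      apply Subtype.ext; simp only [inducedCocycle, Subgroup.coe_mul, mul_smul]; group
    rw [h, mul_smul, mul_inv_rev, mul_smul]

theorem smul_def [MulAction Λ Y] (γ : Γ) (p : InducedSpace hT Y) :
    γ • p = ((γ • p.1, (inducedCocycle hT γ p.1)⁻¹ • p.2) : (Γ ⧸ Λ) × Y) := rfl

instance [TopologicalSpace Γ] [DiscreteTopology Γ] [TopologicalSpace Y] [MulAction Λ Y]
    [ContinuousConstSMul Λ Y] : ContinuousConstSMul Γ (InducedSpace hT Y) where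
  continuous_const_smul γ := by
    have : DiscreteTopology (Γ ⧸ Λ) := QuotientGroup.discreteTopology (isOpen_discrete _)
    change Continuous fun p : (Γ ⧸ Λ) × Y => (γ • p.1, (inducedCocycle hT γ p.1)⁻¹ • p.2)
    refine continuous_prod_of_discrete_left.2 fun q => ?_
    change Continuous fun y : Y => (γ • q, (inducedCocycle hT γ q)⁻¹ • y)
    exact continuous_const.prodMk (continuous_const_smul (T := Y) (inducedCocycle hT γ q)⁻¹)

end InducedSpace

end Induced

/-- `e` is an isomorphism of `G`-spaces. -/
def IsGIso (G : Type u) [Group G] {Y : Type v} {Z : Type w} [TopologicalSpace Y]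
    [TopologicalSpace Z] [MulAction G Y] [MulAction G Z] (e : Y ≃ₜ Z) : Prop :=
  ∀ (g : G) (y : Y), e (g • y) = g • e y

/-!
A measure on a compact Hausdorff space `Y` is a state of `C(Y, ℝ)`, and conversely by the
Riesz–Markov–Kakutani theorem. So strong proximality over `X` says that the orbit closure of every
state supported in a fibre contains a point evaluation (`isStronglyProximalOver_iff`). States form a
compact Hausdorff `G`-space (`StateSpace`), and everything below is topological dynamics on it.

*Induction.* For a representative `t` of `q ∈ Γ/Λ`, the group `t Λ t⁻¹` acts on the fibre over `q` of
the induced space as `Λ` acts on `Y`, so a state in that fibre is contracted because `Y` is strongly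
proximal (`InducedSpace.isBoundaryOver`).

*Restriction.* A finite minimal space `X` is discrete and transitive, so the fibre of `φ : Y → X` over
`x` is clopen. An element of `Γ` that carries a point of this fibre into the fibre lies in the
stabilizer of `x`. Hence the fibre is a boundary of the stabilizer (`IsBoundaryOver.isBoundary_fibre`),
and `(q, y) ↦ t y` identifies the space induced from it with `Y` (`exists_inducedSpace_fibre_iso`).

*The Furstenberg boundary.* A minimal set `L` of ultrafilters on `G` maps to every nonempty
compact Hausdorff `G`-space. Identify the points of `L` that no `G`-map to a boundary separates. The quotient is
strongly proximal: on a strongly proximal space, a minimal set of states consists of point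
evaluations, so in a minimal set of states on the quotient all marginals on boundaries are point
evaluations, and such a state is itself one (`StateSpace.exists_eq_eval_of_separating`).

*The universal boundary over `X`.* By restriction, every boundary over `X` is an image of the space
induced from the Furstenberg boundary of the stabilizer, which is thus universal
(`isUniversalBoundaryOver_inducedSpace`). Universal boundaries are unique by rigidity
(`IsBoundaryOver.gMap_unique`).
-/

/-! ### The state space of `C(Y, ℝ)` -/

/-- The states of `C(Y, ℝ)`, that is the positive unital linear functionals, with the topology of
pointwise convergence. They are encoded as bare functions, so that compactness is Tychonoff's
theorem. -/
def StateSpace (Y : Type v) [TopologicalSpace Y] : Type v :=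
  {s : C(Y, ℝ) → ℝ // (∀ f g, s (f + g) = s f + s g) ∧ (∀ (c : ℝ) f, s (c • f) = c * s f) ∧
    (∀ f, 0 ≤ f → 0 ≤ s f) ∧ s 1 = 1}

namespace StateSpace

section Basic

variable {Y : Type v} [TopologicalSpace Y]

instance : TopologicalSpace (StateSpace Y) := inferInstanceAs (TopologicalSpace (Subtype _))

instance : T2Space (StateSpace Y) := inferInstanceAs (T2Space (Subtype _))

instance : FunLike (StateSpace Y) C(Y, ℝ) ℝ where
  coe s := s.1
  coe_injective := Subtype.val_injective

@[ext]
theorem ext {s t : StateSpace Y} (h : ∀ f, s f = t f) : s = t := DFunLike.ext _ _ h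

theorem map_add (s : StateSpace Y) (f g : C(Y, ℝ)) : s (f + g) = s f + s g := s.2.1 f g

theorem map_smul (s : StateSpace Y) (c : ℝ) (f : C(Y, ℝ)) : s (c • f) = c * s f := s.2.2.1 c f

theorem map_nonneg (s : StateSpace Y) {f : C(Y, ℝ)} (hf : 0 ≤ f) : 0 ≤ s f := s.2.2.2.1 f hf

theorem map_one (s : StateSpace Y) : s 1 = 1 := s.2.2.2.2

/-- A state as a linear functional. -/
def toLinearMap (s : StateSpace Y) : C(Y, ℝ) →ₗ[ℝ] ℝ where
  toFun := s
  map_add' := s.map_add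
  map_smul' := s.map_smul

theorem map_sub (s : StateSpace Y) (f g : C(Y, ℝ)) : s (f - g) = s f - s g :=
  _root_.map_sub s.toLinearMap f g

theorem map_zero (s : StateSpace Y) : s 0 = 0 := _root_.map_zero s.toLinearMap

theorem map_sum (s : StateSpace Y) {ι : Type*} (t : Finset ι) (f : ι → C(Y, ℝ)) :
    s (∑ i ∈ t, f i) = ∑ i ∈ t, s (f i) := _root_.map_sum s.toLinearMap f t

theorem mono (s : StateSpace Y) {f g : C(Y, ℝ)} (h : f ≤ g) : s f ≤ s g := by
  have := s.map_nonneg (sub_nonneg.2 h)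
  rw [s.map_sub] at this
  linarith

theorem abs_le_norm [CompactSpace Y] (s : StateSpace Y) (f : C(Y, ℝ)) : |s f| ≤ ‖f‖ := by
  have h1 : f ≤ ‖f‖ • (1 : C(Y, ℝ)) := fun y => by
    simpa using (le_abs_self _).trans (f.norm_coe_le_norm y)
  have h2 : (-‖f‖) • (1 : C(Y, ℝ)) ≤ f := fun y => by
    simpa using neg_le.1 ((neg_le_abs _).trans (f.norm_coe_le_norm y))
  have h1' := s.mono h1
  have h2' := s.mono h2
  rw [s.map_smul, s.map_one, mul_one] at h1' h2'
  exact abs_le.2 ⟨h2', h1'⟩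

theorem continuous_apply (f : C(Y, ℝ)) : Continuous fun s : StateSpace Y => s f :=
  (_root_.continuous_apply f).comp continuous_subtype_val

theorem isInducing_coe : IsInducing fun (s : StateSpace Y) (f : C(Y, ℝ)) => s f :=
  IsInducing.subtypeVal

theorem continuous_iff {Z : Type*} [TopologicalSpace Z] {F : Z → StateSpace Y} :
    Continuous F ↔ ∀ f : C(Y, ℝ), Continuous fun z => F z f := by
  rw [isInducing_coe.continuous_iff, continuous_pi_iff]; rfl

instance [CompactSpace Y] : CompactSpace (StateSpace Y) := by
  refine isCompact_iff_compactSpace.1 (IsCompact.of_isClosed_subset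
    (isCompact_univ_pi fun f : C(Y, ℝ) => isCompact_Icc (a := -‖f‖) (b := ‖f‖)) ?_ ?_)
  · change IsClosed {s : C(Y, ℝ) → ℝ | (∀ f g, s (f + g) = s f + s g) ∧
      (∀ (c : ℝ) f, s (c • f) = c * s f) ∧ (∀ f, 0 ≤ f → 0 ≤ s f) ∧ s 1 = 1}
    simp only [ofPred_and, ofPred_forall]
    refine IsClosed.inter ?_ (IsClosed.inter ?_ (IsClosed.inter ?_ ?_))
    · exact isClosed_iInter fun f => isClosed_iInter fun g => isClosed_eq (by fun_prop) (by fun_prop)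
    · exact isClosed_iInter fun f => isClosed_iInter fun g => isClosed_eq (by fun_prop) (by fun_prop)
    · exact isClosed_iInter fun f => isClosed_iInter fun _ => isClosed_le (by fun_prop) (by fun_prop)
    · exact isClosed_eq (by fun_prop) (by fun_prop)
  · intro s hs f _
    exact abs_le.1 (abs_le_norm (⟨s, hs⟩ : StateSpace Y) f)

/-- The evaluation state at a point. -/
def eval (y : Y) : StateSpace Y :=
  ⟨fun f => f y, fun _ _ => rfl, fun _ _ => rfl, fun _ hf => hf y, rfl⟩

@[simp] theorem eval_apply (y : Y) (f : C(Y, ℝ)) : eval y f = f y := rfl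

theorem continuous_eval : Continuous (eval : Y → StateSpace Y) :=
  continuous_iff.2 fun f => f.continuous

/-- The midpoint of two evaluation states. -/
noncomputable def midpointEval (y z : Y) : StateSpace Y :=
  ⟨fun f => (f y + f z) / 2, fun f g => by simp; ring, fun c f => by simp; ring,
    fun f hf => by have := hf y; have := hf z; simp at *; positivity, by simp⟩

/-- The push-forward of states along a continuous map. -/
def map {Z : Type w} [TopologicalSpace Z] (h : C(Y, Z)) (s : StateSpace Y) : StateSpace Z :=
  ⟨fun f => s (f.comp h), fun f g => s.map_add (f.comp h) (g.comp h),
    fun c f => s.map_smul c (f.comp h),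
    fun _ hf => s.map_nonneg fun y => hf (h y), s.map_one⟩

@[simp] theorem map_apply {Z : Type w} [TopologicalSpace Z] (h : C(Y, Z)) (s : StateSpace Y)
    (f : C(Z, ℝ)) : s.map h f = s (f.comp h) := rfl

theorem continuous_map {Z : Type w} [TopologicalSpace Z] (h : C(Y, Z)) :
    Continuous (map h : StateSpace Y → StateSpace Z) :=
  continuous_iff.2 fun f => continuous_apply (f.comp h)

/-- A state is supported on `A` if it vanishes on the functions that vanish on `A`. -/
def SupportedOn (s : StateSpace Y) (A : Set Y) : Prop :=
  ∀ f : C(Y, ℝ), (∀ y ∈ A, f y = 0) → s f = 0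

theorem SupportedOn.congr {s : StateSpace Y} {A : Set Y} (hs : s.SupportedOn A) {f g : C(Y, ℝ)}
    (h : EqOn f g A) : s f = s g := by
  rw [← sub_eq_zero, ← s.map_sub]
  exact hs _ fun y hy => by simp [h hy]

/-- If `f` lies below annihilated nonnegative functions pointwise, with a function depending on the
point, then `s f ≤ 0`: by compactness `f` lies below a finite sum of such functions. -/
theorem nonpos_of_forall_exists [CompactSpace Y] (s : StateSpace Y) (f : C(Y, ℝ))
    (H : ∀ y, ∃ d : C(Y, ℝ), 0 ≤ d ∧ s d = 0 ∧ f y < d y) : s f ≤ 0 := by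
  choose d hd0 hsd hdy using H
  obtain ⟨t, ht⟩ := isCompact_univ.elim_finite_subcover (fun z => {y | f y < d z y})
    (fun z => isOpen_lt f.continuous (d z).continuous) fun z _ => mem_iUnion.2 ⟨z, hdy z⟩
  have hle : ∀ y, f y ≤ (∑ z ∈ t, d z) y := fun y => by
    obtain ⟨z, hz, hy⟩ := mem_iUnion₂.1 (ht (mem_univ y))
    rw [ContinuousMap.sum_apply]
    exact (le_of_lt hy).trans
      (Finset.single_le_sum (f := fun z => d z y) (fun z _ => hd0 z y) hz)
  calc s f ≤ s (∑ z ∈ t, d z) := s.mono hle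
    _ = 0 := by rw [s.map_sum]; exact Finset.sum_eq_zero fun z _ => hsd z

theorem exists_common_zero [CompactSpace Y] (s : StateSpace Y) :
    ∃ z, ∀ d : C(Y, ℝ), 0 ≤ d → s d = 0 → d z = 0 := by
  by_contra! H
  have : s 1 ≤ 0 := s.nonpos_of_forall_exists 1 fun y => by
    obtain ⟨d, hd0, hsd, hdy⟩ := H y
    have hpos : 0 < d y := lt_of_le_of_ne (hd0 y) hdy.symm
    refine ⟨(2 / d y) • d, fun x => ?_, by rw [s.map_smul, hsd, mul_zero], ?_⟩
    · exact mul_nonneg (div_pos two_pos hpos).le (hd0 x)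
    · simp [hpos.ne']
  rw [s.map_one] at this
  exact zero_lt_one.not_ge this

/-- A state on a compact space is the evaluation at `z` as soon as it annihilates nonnegative
functions that separate every other point from `z`. -/
theorem eq_eval_of_forall_exists [CompactSpace Y] (s : StateSpace Y) (z : Y)
    (H : ∀ y, y ≠ z → ∃ d : C(Y, ℝ), 0 ≤ d ∧ s d = 0 ∧ 0 < d y) : s = eval z := by
  have key : ∀ f : C(Y, ℝ), s f ≤ f z := by
    intro f
    refine le_of_forall_pos_le_add fun ε hε => ?_
    have : s (f - (f z + ε) • 1) ≤ 0 := s.nonpos_of_forall_exists _ fun y => by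
      by_cases hy : y = z
      · exact ⟨0, le_rfl, s.map_zero, by simp [hy, hε]⟩
      obtain ⟨d, hd0, hsd, hdy⟩ := H y hy
      obtain ⟨n, hn⟩ := exists_nat_gt ((f y - (f z + ε)) / d y)
      refine ⟨(n : ℝ) • d, fun x => mul_nonneg n.cast_nonneg (hd0 x),
        by rw [s.map_smul, hsd, mul_zero], ?_⟩
      simpa using (div_lt_iff₀ hdy).1 hn
    rw [s.map_sub, s.map_smul, s.map_one] at this
    linarith
  refine ext fun f => le_antisymm (key f) ?_
  have h := key (-f)
  rw [← zero_sub, s.map_sub, s.map_zero] at h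
  simpa using h

end Basic

section Action

variable {G : Type u} [Group G] {Y : Type v} [TopologicalSpace Y] [MulAction G Y]
  [ContinuousConstSMul G Y]

/-- The translation by a group element, as a continuous map. -/
def translation (Y : Type v) [TopologicalSpace Y] [MulAction G Y] [ContinuousConstSMul G Y]
    (g : G) : C(Y, Y) := ⟨(g • ·), continuous_const_smul g⟩

@[simp] theorem translation_apply (g : G) (y : Y) : translation Y g y = g • y := rfl

instance : MulAction G (StateSpace Y) where
  smul g s := s.map (translation Y g)
  one_smul s := ext fun f => congrArg s (ContinuousMap.ext fun y => congrArg f (one_smul G y))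
  mul_smul g h s := ext fun f =>
    congrArg s (ContinuousMap.ext fun y => congrArg f (mul_smul g h y))

theorem smul_apply (g : G) (s : StateSpace Y) (f : C(Y, ℝ)) :
    (g • s) f = s (f.comp (translation Y g)) := rfl

instance : ContinuousConstSMul G (StateSpace Y) := ⟨fun g => continuous_map (translation Y g)⟩

theorem map_smul_of_equivariant {Z : Type w} [TopologicalSpace Z] [MulAction G Z]
    [ContinuousConstSMul G Z] {h : C(Y, Z)} (hh : ∀ (g : G) y, h (g • y) = g • h y) (g : G)
    (s : StateSpace Y) : (g • s).map h = g • s.map h :=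
  ext fun f => congrArg s (ContinuousMap.ext fun y => congrArg f (hh g y))

end Action

/-! ### States and regular probability measures -/

section Measure

theorem _root_.ContinuousMap.integrable_probabilityMeasure {Y : Type v} [TopologicalSpace Y]
    [CompactSpace Y] [MeasurableSpace Y] [BorelSpace Y] (f : C(Y, ℝ))
    (ν : ProbabilityMeasure Y) : Integrable f (ν : Measure Y) :=
  (BoundedContinuousFunction.mkOfCompact f).integrable _

variable {Y : Type v} [TopologicalSpace Y] [CompactSpace Y] [MeasurableSpace Y] [BorelSpace Y]

/-- Integration against a Borel probability measure. -/
noncomputable def ofMeasure (ν : ProbabilityMeasure Y) : StateSpace Y :=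
  ⟨fun f => ∫ y, f y ∂(ν : Measure Y),
    fun f g => integral_add (f.integrable_probabilityMeasure ν) (g.integrable_probabilityMeasure ν),
    fun c f => integral_const_mul c f,
    fun f hf => integral_nonneg hf,
    by simp⟩

theorem ofMeasure_apply (ν : ProbabilityMeasure Y) (f : C(Y, ℝ)) :
    ofMeasure ν f = ∫ y, f y ∂(ν : Measure Y) := rfl

theorem isInducing_ofMeasure : IsInducing (ofMeasure : ProbabilityMeasure Y → StateSpace Y) := by
  have hcont : Continuous (ofMeasure : ProbabilityMeasure Y → StateSpace Y) :=
    continuous_iff.2 fun f => continuous_iff_continuousAt.2 fun ν =>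
      ProbabilityMeasure.tendsto_iff_forall_integral_tendsto.1 Filter.tendsto_id
        (BoundedContinuousFunction.mkOfCompact f)
  refine isInducing_iff_nhds.2 fun ν => le_antisymm (hcont.tendsto ν).le_comap ?_
  refine Filter.tendsto_id'.1 (ProbabilityMeasure.tendsto_iff_forall_integral_tendsto.2 fun f => ?_)
  exact ((continuous_apply f.toContinuousMap).tendsto _).comp Filter.tendsto_comap

theorem ofMeasure_diracProba (y : Y) : ofMeasure (diracProba y) = eval y :=
  ext fun f => by
    rw [ofMeasure_apply]
    exact integral_dirac' _ _ f.continuous.stronglyMeasurable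

theorem ofMeasure_translateProb {G : Type u} [Group G] [MulAction G Y] [ContinuousConstSMul G Y]
    (g : G) (ν : ProbabilityMeasure Y) : ofMeasure (translateProb g ν) = g • ofMeasure ν :=
  ext fun f => by
    rw [ofMeasure_apply, smul_apply, ofMeasure_apply]
    exact integral_map (continuous_const_smul (T := Y) g).measurable.aemeasurable
      f.continuous.aestronglyMeasurable

theorem contractsToPoint_iff {G : Type u} [Group G] [MulAction G Y] [ContinuousConstSMul G Y]
    (ν : ProbabilityMeasure Y) :
    ContractsToPoint G ν ↔ ∃ y, eval y ∈ closure (MulAction.orbit G (ofMeasure ν)) := by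
  refine exists_congr fun y => ?_
  rw [isInducing_ofMeasure.closure_eq_preimage_closure_image, mem_preimage, ofMeasure_diracProba,
    ← range_comp]
  simp only [Function.comp_def, ofMeasure_translateProb]
  rfl

variable [T2Space Y]

/-- Every state is given by a regular probability measure, by the Riesz–Markov–Kakutani theorem. -/
theorem exists_regular_ofMeasure_eq (s : StateSpace Y) :
    ∃ ν : ProbabilityMeasure Y, (ν : Measure Y).Regular ∧ ofMeasure ν = s := by
  let l : CompactlySupportedContinuousMap Y ℝ →ₗ[ℝ] ℝ :=
    { toFun := fun f => s f.toContinuousMap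
      map_add' := fun f g => s.map_add f.toContinuousMap g.toContinuousMap
      map_smul' := fun c f => s.map_smul c f.toContinuousMap }
  let L : CompactlySupportedContinuousMap Y ℝ →ₚ[ℝ] ℝ :=
    PositiveLinearMap.mk₀ l fun f hf => s.map_nonneg hf
  have hint : ∀ f : C(Y, ℝ), ∫ y, f y ∂(RealRMK.rieszMeasure L) = s f := fun f =>
    RealRMK.integral_rieszMeasure L (CompactlySupportedContinuousMap.continuousMapEquiv f)
  have hfin : IsFiniteMeasure (RealRMK.rieszMeasure L) := inferInstance
  have hprob : IsProbabilityMeasure (RealRMK.rieszMeasure L) := by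
    have h := hint 1
    rw [s.map_one] at h
    simp only [ContinuousMap.one_apply, integral_const, smul_eq_mul, mul_one] at h
    refine ⟨?_⟩
    rw [← ENNReal.toReal_eq_one_iff]
    exact h
  exact ⟨⟨RealRMK.rieszMeasure L, hprob⟩, inferInstanceAs (RealRMK.rieszMeasure L).Regular,
    ext hint⟩

theorem supportedOn_ofMeasure_iff {ν : ProbabilityMeasure Y} (hν : (ν : Measure Y).Regular)
    {A : Set Y} (hA : IsClosed A) :
    (ofMeasure ν).SupportedOn A ↔ (ν : Measure Y).support ⊆ A := by
  constructor
  · intro h y hy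
    by_contra hyA
    obtain ⟨f, hfA, hfy, hf⟩ := exists_continuous_zero_one_of_isClosed hA
      (isClosed_singleton (x := y)) (disjoint_singleton_right.2 hyA)
    have h0 : ∫ z, f z ∂(ν : Measure Y) = 0 := h f hfA
    have hae := (integral_eq_zero_iff_of_nonneg (fun z => (hf z).1)
      (f.integrable_probabilityMeasure ν)).1 h0
    have hU : {z | 0 < f z} ∈ 𝓝 y := (isOpen_lt continuous_const f.continuous).mem_nhds
      (by have := hfy rfl; simp_all)
    refine (Measure.mem_support_iff_forall y).1 hy _ hU |>.ne' ?_
    refine measure_mono_null (fun z (hz : 0 < f z) => ?_) hae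
    exact hz.ne'
  · intro h f hf
    have hae : f =ᵐ[(ν : Measure Y)] 0 :=
      Filter.mem_of_superset Measure.support_mem_ae_of_regular fun y hy => hf y (h hy)
    rw [ofMeasure_apply, integral_congr_ae hae]
    simp

end Measure

end StateSpace

/-! ### Strong proximality in terms of states -/

section Proximality

open StateSpace

variable {G : Type u} [Group G] {Y : Type v} [TopologicalSpace Y] [CompactSpace Y] [T2Space Y]
  [MulAction G Y] [ContinuousConstSMul G Y]

/-- Strong proximality over `X` expressed through states; this removes measurability and regularity
from the rest of the argument. -/
theorem isStronglyProximalOver_iff {X : Type w} [TopologicalSpace X] [T1Space X] {φ : Y → X}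
    (hφ : Continuous φ) : IsStronglyProximalOver G φ ↔
      ∀ (x : X) (s : StateSpace Y), s.SupportedOn (φ ⁻¹' {x}) →
        ∃ y, eval y ∈ closure (MulAction.orbit G s) := by
  constructor
  · intro h x s hs
    let _ : MeasurableSpace Y := borel Y
    have : BorelSpace Y := ⟨rfl⟩
    obtain ⟨ν, hν, rfl⟩ := exists_regular_ofMeasure_eq s
    exact (contractsToPoint_iff ν).1
      (h ν hν x ((supportedOn_ofMeasure_iff hν (isClosed_singleton.preimage hφ)).1 hs))
  · intro h _ _ ν hν x hx
    exact (contractsToPoint_iff ν).2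
      (h x _ ((supportedOn_ofMeasure_iff hν (isClosed_singleton.preimage hφ)).2 hx))

theorem isStronglyProximal_iff : IsStronglyProximal G Y ↔
    ∀ s : StateSpace Y, ∃ y, eval y ∈ closure (MulAction.orbit G s) := by
  have h1 : IsStronglyProximal G Y ↔ IsStronglyProximalOver G fun _ : Y => PUnit.unit.{1} :=
    ⟨fun h _ _ ν hν _ _ => h ν hν, fun h _ _ ν hν => h ν hν PUnit.unit fun _ _ => rfl⟩
  rw [h1, isStronglyProximalOver_iff continuous_const]
  exact ⟨fun h s => h PUnit.unit s fun f hf => by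
    rw [show f = 0 from ContinuousMap.ext fun y => hf y rfl, s.map_zero], fun h _ s _ => h s⟩

end Proximality

/-! ### Minimal sets -/

/-- `M` is a minimal set of a `G`-space: minimal among the nonempty closed invariant subsets. -/
structure IsMinimalSet (G : Type u) [Group G] {Y : Type v} [TopologicalSpace Y] [MulAction G Y]
    (M : Set Y) : Prop where
  isClosed : IsClosed M
  nonempty : M.Nonempty
  smul_mem : ∀ (g : G), ∀ y ∈ M, g • y ∈ M
  eq_of_subset : ∀ N ⊆ M, IsClosed N → N.Nonempty → (∀ (g : G), ∀ y ∈ N, g • y ∈ N) → N = M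

section MinimalSets

variable {G : Type u} [Group G] {Y : Type v} [TopologicalSpace Y] [MulAction G Y]

theorem exists_isMinimalSet_subset [CompactSpace Y] {K : Set Y} (hK : IsClosed K)
    (hne : K.Nonempty) (hinv : ∀ (g : G), ∀ y ∈ K, g • y ∈ K) : ∃ M ⊆ K, IsMinimalSet G M := by
  obtain ⟨M, hMK, hM⟩ := zorn_superset_nonempty
    {N : Set Y | IsClosed N ∧ N.Nonempty ∧ ∀ (g : G), ∀ y ∈ N, g • y ∈ N} (by
      intro c hc hchain hcne
      refine ⟨⋂₀ c, ⟨isClosed_sInter fun N hN => (hc hN).1, ?_, ?_⟩, fun N => sInter_subset_of_mem⟩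
      · have : Nonempty c := hcne.to_subtype
        exact IsCompact.nonempty_sInter_of_directed_nonempty_isCompact_isClosed
          (show IsChain (· ⊇ ·) c from hchain.symm).directedOn
          (fun N hN => (hc hN).2.1) (fun N hN => (hc hN).1.isCompact) fun N hN => (hc hN).1
      · exact fun g y hy N hN => (hc hN).2.2 g y (hy N hN)) K ⟨hK, hne, hinv⟩
  exact ⟨M, hMK, hM.prop.1, hM.prop.2.1, hM.prop.2.2, fun N hNM h1 h2 h3 =>
    hNM.antisymm (hM.le_of_le ⟨h1, h2, h3⟩ hNM)⟩

theorem closure_orbit_smul_mem [ContinuousConstSMul G Y] (y : Y) (g : G) (z : Y)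
    (hz : z ∈ closure (MulAction.orbit G y)) : g • z ∈ closure (MulAction.orbit G y) :=
  smul_closure_orbit_subset g y (smul_mem_smul_set hz)

theorem IsMinimalSet.closure_orbit_eq [ContinuousConstSMul G Y] {M : Set Y}
    (hM : IsMinimalSet G M) {y : Y} (hy : y ∈ M) : closure (MulAction.orbit G y) = M :=
  hM.eq_of_subset _
    (closure_minimal (by rintro _ ⟨g, rfl⟩; exact hM.smul_mem g y hy) hM.isClosed)
    isClosed_closure (MulAction.nonempty_orbit y).closure (closure_orbit_smul_mem y)

theorem IsMinimalSet.image [CompactSpace Y] {Z : Type w} [TopologicalSpace Z] [T2Space Z]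
    [MulAction G Z] {M : Set Y} (hM : IsMinimalSet G M) {h : Y → Z} (hh : IsGMap G h) :
    IsMinimalSet G (h '' M) where
  isClosed := (hM.isClosed.isCompact.image hh.continuous).isClosed
  nonempty := hM.nonempty.image h
  smul_mem := by
    rintro g _ ⟨y, hy, rfl⟩
    exact ⟨g • y, hM.smul_mem g y hy, hh.map_smul g y⟩
  eq_of_subset N hN hcl hne hinv := by
    have h1 : M ∩ h ⁻¹' N = M := by
      refine hM.eq_of_subset _ inter_subset_left (hM.isClosed.inter (hcl.preimage hh.continuous))
        ?_ fun g y hy => ⟨hM.smul_mem g y hy.1, ?_⟩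
      · obtain ⟨z, hz⟩ := hne
        obtain ⟨y, hy, rfl⟩ := hN hz
        exact ⟨y, hy, hz⟩
      · rw [mem_preimage, hh.map_smul]
        exact hinv g _ hy.2
    refine hN.antisymm ?_
    rintro _ ⟨y, hy, rfl⟩
    rw [← h1] at hy
    exact hy.2

theorem MulAction.IsMinimal.eq_univ [MulAction.IsMinimal G Y] {K : Set Y} (hK : IsClosed K)
    (hne : K.Nonempty) (hinv : ∀ (g : G), ∀ y ∈ K, g • y ∈ K) : K = univ :=
  (eq_empty_or_univ_of_smul_invariant_closed G hK
    fun g => by rintro _ ⟨y, hy, rfl⟩; exact hinv g y hy).resolve_left hne.ne_empty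

/-- A `G`-map from a nonempty compact space to a minimal one is onto. -/
theorem IsGMap.isExtension [CompactSpace Y] [Nonempty Y] {Z : Type w} [TopologicalSpace Z]
    [T2Space Z] [MulAction G Z] [MulAction.IsMinimal G Z] {h : Y → Z} (hh : IsGMap G h) :
    IsExtension G h where
  toIsGMap := hh
  surjective := range_eq_univ.1 <| MulAction.IsMinimal.eq_univ (G := G)
    (isCompact_range hh.continuous).isClosed (range_nonempty h) <| by
      rintro g _ ⟨y, rfl⟩
      exact ⟨g • y, hh.map_smul g y⟩

/-- A minimal set of states on a strongly proximal space consists of point evaluations. -/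
theorem IsMinimalSet.exists_eq_eval [CompactSpace Y] [T2Space Y] [ContinuousConstSMul G Y]
    (hY : IsStronglyProximal G Y) {M : Set (StateSpace Y)} (hM : IsMinimalSet G M)
    {s : StateSpace Y} (hs : s ∈ M) : ∃ y, s = StateSpace.eval y := by
  obtain ⟨y, hy⟩ := isStronglyProximal_iff.1 hY s
  rw [hM.closure_orbit_eq hs] at hy
  have h1 : M ∩ range StateSpace.eval = M := by
    refine hM.eq_of_subset _ inter_subset_left
      (hM.isClosed.inter (isCompact_range StateSpace.continuous_eval).isClosed)
      ⟨_, hy, y, rfl⟩ ?_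
    rintro g _ ⟨ht, z, rfl⟩
    exact ⟨hM.smul_mem g _ ht, g • z, rfl⟩
  rw [← h1] at hs
  obtain ⟨-, z, rfl⟩ := hs
  exact ⟨z, rfl⟩

end MinimalSets

/-! ### The universal minimal space -/

section UniversalMinimal

variable {G : Type u} [Group G]

/-- Left translation of ultrafilters on `G`. -/
instance Ultrafilter.translationAction : MulAction G (Ultrafilter G) where
  smul g p := p.map (g * ·)
  one_smul p := Ultrafilter.coe_injective (by
    change Filter.map (fun x => 1 * x) (p : Filter G) = p
    simp)
  mul_smul g h p := Ultrafilter.coe_injective (by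
    change Filter.map _ (p : Filter G) = Filter.map _ (Filter.map _ (p : Filter G))
    rw [Filter.map_map]
    exact congrArg (Filter.map · _) (funext fun x => mul_assoc g h x))

theorem Ultrafilter.coe_translate (g : G) (p : Ultrafilter G) :
    ((g • p : Ultrafilter G) : Filter G) = Filter.map (g * ·) (p : Filter G) := rfl

instance : ContinuousConstSMul G (Ultrafilter G) where
  continuous_const_smul g := by
    refine ultrafilterBasis_is_basis.continuous_iff.2 ?_
    rintro _ ⟨s, rfl⟩
    exact ultrafilter_isOpen_basic ((g * ·) ⁻¹' s)

/-- Any point `w` of a compact Hausdorff `G`-space extends to a `G`-map from the ultrafilters, the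
limit of the orbit map along an ultrafilter. -/
theorem isGMap_ultrafilterExtend {W : Type v} [TopologicalSpace W] [CompactSpace W] [T2Space W]
    [MulAction G W] [ContinuousConstSMul G W] (w : W) :
    IsGMap G (Ultrafilter.extend fun g : G => g • w) where
  continuous := continuous_ultrafilter_extend _
  map_smul g p := by
    have h : Filter.Tendsto (fun g : G => g • w) p _ :=
      (ultrafilter_extend_eq_iff (f := fun g : G => g • w) (b := p)).1 rfl
    refine ultrafilter_extend_eq_iff.2 ?_
    have h2 := ((continuous_const_smul g).tendsto _).comp h
    rw [Ultrafilter.coe_map, Ultrafilter.coe_translate, Filter.map_map]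
    simp only [Function.comp_def, smul_smul] at h2 ⊢
    exact h2

/-- There is a minimal compact Hausdorff `G`-space that maps to every nonempty compact Hausdorff
`G`-space: any minimal set of ultrafilters on `G`. -/
theorem exists_universal_minimal (G : Type u) [Group G] :
    ∃ (L : Type u) (_ : TopologicalSpace L) (_ : CompactSpace L) (_ : T2Space L)
      (_ : MulAction G L) (_ : ContinuousConstSMul G L), Nonempty L ∧ MulAction.IsMinimal G L ∧
      ∀ (W : Type v) [TopologicalSpace W] [CompactSpace W] [T2Space W] [MulAction G W]
        [ContinuousConstSMul G W] [Nonempty W], ∃ h : L → W, IsGMap G h := by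
  obtain ⟨M, -, hM⟩ := exists_isMinimalSet_subset (G := G) (Y := Ultrafilter G) isClosed_univ
    ⟨pure 1, mem_univ _⟩ fun _ _ _ => mem_univ _
  let L : SubMulAction G (Ultrafilter G) := ⟨M, fun g {y} hy => hM.smul_mem g y hy⟩
  have hcont : ContinuousConstSMul G L :=
    ⟨fun g => ((continuous_const_smul g).comp continuous_subtype_val).subtype_mk _⟩
  refine ⟨L, inferInstance, isCompact_iff_compactSpace.1 hM.isClosed.isCompact, inferInstance,
    inferInstance, hcont, hM.nonempty.to_subtype, ?_, fun W => ?_⟩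
  · refine ⟨fun p => Subtype.dense_iff.2 fun q hq => ?_⟩
    rw [MulAction.orbit, ← range_comp]
    exact (hM.closure_orbit_eq p.2).ge hq
  · intro _ _ _ _ _ _
    have h := isGMap_ultrafilterExtend (G := G) (Classical.arbitrary W)
    exact ⟨_, h.continuous.comp continuous_subtype_val, fun g p => h.map_smul g p⟩

end UniversalMinimal

/-! ### The Furstenberg boundary -/

/-- A state is a point evaluation if its marginals under a separating family of maps are. -/
theorem StateSpace.exists_eq_eval_of_separating {F : Type v} [TopologicalSpace F] [CompactSpace F]
    (s : StateSpace F)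
    (H : ∀ z w : F, z ≠ w → ∃ (Y : Type w) (_ : TopologicalSpace Y) (_ : CompactSpace Y)
      (_ : T2Space Y) (h : C(F, Y)), h z ≠ h w ∧ ∃ y, s.map h = eval y) :
    ∃ z, s = eval z := by
  obtain ⟨z, hz⟩ := s.exists_common_zero
  refine ⟨z, s.eq_eval_of_forall_exists z fun w hwz => ?_⟩
  obtain ⟨Y, _, _, _, h, hne, y, hy⟩ := H z w hwz.symm
  have hval : ∀ f : C(Y, ℝ), s (f.comp h) = f y := fun f => by rw [← map_apply, hy, eval_apply]
  -- the marginal is the evaluation at the image of `z`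
  have hyz : h z = y := by
    by_contra hyz
    obtain ⟨f, hf0, hf1, hf⟩ := exists_continuous_zero_one_of_isClosed (isClosed_singleton (x := y))
      (isClosed_singleton (x := h z)) (disjoint_singleton.2 (Ne.symm hyz))
    have h0 : f (h z) = 0 := hz (f.comp h) (fun x => (hf (h x)).1) ((hval f).trans (hf0 rfl))
    have h1 : f (h z) = 1 := hf1 rfl
    exact zero_ne_one (h0.symm.trans h1)
  obtain ⟨f, hf0, hf1, hf⟩ := exists_continuous_zero_one_of_isClosed (isClosed_singleton (x := h z))
    (isClosed_singleton (x := h w)) (disjoint_singleton.2 hne)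
  refine ⟨f.comp h, fun x => (hf (h x)).1, ?_, ?_⟩
  · rw [hval, ← hyz]; exact hf0 rfl
  · have h1 : f (h w) = 1 := hf1 rfl
    simp [h1]

section Furstenberg

variable (G : Type u) [Group G] (L : Type v) [TopologicalSpace L] [MulAction G L]

/-- Two points of `L` are identified when no `G`-map from `L` to a `G`-boundary separates them. -/
def boundarySetoid : Setoid L where
  r p q := ∀ (Y : Type v) [TopologicalSpace Y] [CompactSpace Y] [T2Space Y] [MulAction G Y]
    [ContinuousConstSMul G Y], IsBoundary G Y → ∀ h : L → Y, IsGMap G h → h p = h q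
  iseqv := ⟨fun _ _ _ _ _ _ _ _ _ _ => rfl,
    fun H Y _ _ _ _ _ hY h hh => (H Y hY h hh).symm,
    fun H H' Y _ _ _ _ _ hY h hh => (H Y hY h hh).trans (H' Y hY h hh)⟩

/-- The largest quotient of `L` whose points are separated by `G`-maps to `G`-boundaries. -/
def BoundaryQuotient : Type v := Quotient (boundarySetoid G L)

namespace BoundaryQuotient

variable {G L}

/-- The quotient map. -/
def mk (p : L) : BoundaryQuotient G L := Quotient.mk (boundarySetoid G L) p

theorem mk_surjective : Function.Surjective (mk : L → BoundaryQuotient G L) :=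
  Quotient.mk_surjective

instance : TopologicalSpace (BoundaryQuotient G L) :=
  inferInstanceAs (TopologicalSpace (Quotient (boundarySetoid G L)))

instance [CompactSpace L] : CompactSpace (BoundaryQuotient G L) :=
  inferInstanceAs (CompactSpace (Quotient (boundarySetoid G L)))

theorem isQuotientMap_mk : IsQuotientMap (mk : L → BoundaryQuotient G L) :=
  isQuotientMap_quotient_mk'

variable {Y : Type v} [TopologicalSpace Y] [CompactSpace Y] [T2Space Y] [MulAction G Y]
  [ContinuousConstSMul G Y]

/-- The factorization of a `G`-map to a boundary through the quotient. -/
def lift (hY : IsBoundary G Y) {h : L → Y} (hh : IsGMap G h) : C(BoundaryQuotient G L, Y) where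
  toFun := Quotient.lift h fun _ _ H => H Y hY h hh
  continuous_toFun := isQuotientMap_mk.continuous_iff.2 hh.continuous

theorem exists_lift_ne {a b : BoundaryQuotient G L} (hab : a ≠ b) :
    ∃ (Y : Type v) (_ : TopologicalSpace Y) (_ : CompactSpace Y) (_ : T2Space Y)
      (_ : MulAction G Y) (_ : ContinuousConstSMul G Y) (hY : IsBoundary G Y) (h : L → Y)
      (hh : IsGMap G h), lift hY hh a ≠ lift hY hh b := by
  obtain ⟨p, rfl⟩ := mk_surjective a
  obtain ⟨q, rfl⟩ := mk_surjective b
  by_contra! H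
  exact hab (Quotient.sound fun Y _ _ _ _ _ hY h hh => H Y _ _ _ _ _ hY h hh)

instance : T2Space (BoundaryQuotient G L) where
  t2 _ _ hab := by
    obtain ⟨Y, _, _, _, _, _, hY, h, hh, hne⟩ := exists_lift_ne hab
    exact separated_by_continuous (lift hY hh).continuous hne

instance : MulAction G (BoundaryQuotient G L) where
  smul g := Quotient.map (g • ·) fun _ _ H Y _ _ _ _ _ hY h hh =>
    (hh.map_smul g _).trans ((congrArg (g • ·) (H Y hY h hh)).trans (hh.map_smul g _).symm)
  one_smul := mk_surjective.forall.2 fun p => congrArg mk (one_smul G p)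
  mul_smul g k := mk_surjective.forall.2 fun p => congrArg mk (mul_smul g k p)

theorem smul_mk (g : G) (p : L) : g • (mk p : BoundaryQuotient G L) = mk (g • p) := rfl

instance [ContinuousConstSMul G L] : ContinuousConstSMul G (BoundaryQuotient G L) where
  continuous_const_smul g := isQuotientMap_mk.continuous_iff.2
    (isQuotientMap_mk.continuous.comp (continuous_const_smul g))

theorem isGMap_lift (hY : IsBoundary G Y) {h : L → Y} (hh : IsGMap G h) : IsGMap G (lift hY hh) where
  continuous := (lift hY hh).continuous
  map_smul g := mk_surjective.forall.2 fun p => hh.map_smul g p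

theorem isMinimal [MulAction.IsMinimal G L] : MulAction.IsMinimal G (BoundaryQuotient G L) where
  dense_orbit := mk_surjective.forall.2 fun p =>
    mk_surjective.denseRange.comp (denseRange_smul G p) isQuotientMap_mk.continuous

/-- A minimal set in the orbit closure of a state consists of point evaluations, because its image
on each boundary does. -/
theorem isStronglyProximal [CompactSpace L] [ContinuousConstSMul G L] :
    IsStronglyProximal G (BoundaryQuotient G L) := by
  refine isStronglyProximal_iff.2 fun s => ?_
  obtain ⟨M, hMs, hM⟩ := exists_isMinimalSet_subset (G := G) isClosed_closure
    (MulAction.nonempty_orbit s).closure (closure_orbit_smul_mem s)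
  obtain ⟨t, ht⟩ := hM.nonempty
  obtain ⟨z, rfl⟩ := t.exists_eq_eval_of_separating fun z w hzw => by
    obtain ⟨Y, _, _, _, _, _, hY, h, hh, hne⟩ := exists_lift_ne hzw
    have hg : IsGMap G (StateSpace.map (lift hY hh)) := ⟨StateSpace.continuous_map _, fun g s =>
      StateSpace.map_smul_of_equivariant (isGMap_lift hY hh).map_smul g s⟩
    exact ⟨Y, _, ‹_›, ‹_›, lift hY hh, hne,
      (hM.image hg).exists_eq_eval hY.stronglyProximal (mem_image_of_mem _ ht)⟩
  exact ⟨z, hMs ht⟩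

end BoundaryQuotient

end Furstenberg

theorem exists_isFurstenbergBoundary (G : Type u) [Group G] :
    ∃ (F : Type u) (_ : TopologicalSpace F) (_ : CompactSpace F) (_ : T2Space F)
      (_ : MulAction G F) (_ : ContinuousConstSMul G F), IsFurstenbergBoundary G F := by
  obtain ⟨L, _, _, _, _, _, hne, hmin, huniv⟩ := exists_universal_minimal.{u, u} G
  have hF : IsBoundary G (BoundaryQuotient G L) :=
    ⟨hne.map BoundaryQuotient.mk, BoundaryQuotient.isMinimal,
      BoundaryQuotient.isStronglyProximal⟩
  refine ⟨BoundaryQuotient G L, _, inferInstance, inferInstance, _, inferInstance, hF,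
    fun Y _ _ _ _ _ hY => ?_⟩
  have := hY.nonempty
  have := hY.minimal
  have := hF.nonempty
  obtain ⟨h, hh⟩ := huniv Y
  exact ⟨_, (BoundaryQuotient.isGMap_lift hY hh).isExtension⟩

/-! ### Rigidity of boundaries over a space -/

section Rigidity

variable {G : Type u} [Group G] {X : Type w} [TopologicalSpace X] [MulAction G X]

theorem StateSpace.continuous_midpointEval {Y : Type v} [TopologicalSpace Y] :
    Continuous fun p : Y × Y => midpointEval p.1 p.2 :=
  continuous_iff.2 fun f => by
    change Continuous fun p : Y × Y => (f p.1 + f p.2) / 2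
    fun_prop

theorem StateSpace.eq_of_midpointEval_eq_eval {Y : Type v} [TopologicalSpace Y] [CompactSpace Y]
    [T2Space Y] {a b z : Y} (h : midpointEval a b = eval z) : a = z ∧ b = z := by
  have key : ∀ c, c = a ∨ c = b → c = z := by
    intro c hc
    by_contra hcz
    obtain ⟨f, hf0, hf1, hf⟩ := exists_continuous_zero_one_of_isClosed
      (isClosed_singleton (x := z)) (isClosed_singleton (x := c)) (disjoint_singleton.2 (Ne.symm hcz))
    have h0 : f z = 0 := hf0 rfl
    have h1 : f c = 1 := hf1 rfl
    have h2 : (f a + f b) / 2 = f z := DFunLike.congr_fun h f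
    have ha := (hf a).1
    have hb := (hf b).1
    rcases hc with rfl | rfl <;> linarith
  exact ⟨key a (Or.inl rfl), key b (Or.inr rfl)⟩

/-- Two `G`-maps over `X` from a minimal space to a `(G, X)`-boundary agree: contracting the midpoint
of the two image point masses of a point yields a point at which they agree. -/
theorem IsBoundaryOver.gMap_unique [T1Space X] {Z : Type v} [TopologicalSpace Z] [CompactSpace Z]
    [T2Space Z] [MulAction G Z] [ContinuousConstSMul G Z] {π : Z → X} (hπ : IsBoundaryOver G π)
    {Y : Type v} [TopologicalSpace Y] [CompactSpace Y] [MulAction G Y] [MulAction.IsMinimal G Y]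
    [Nonempty Y] {h₁ h₂ : Y → Z} (hh₁ : IsGMap G h₁) (hh₂ : IsGMap G h₂)
    (hover : ∀ y, π (h₁ y) = π (h₂ y)) : h₁ = h₂ := by
  obtain ⟨y⟩ := ‹Nonempty Y›
  let s := StateSpace.midpointEval (h₁ y) (h₂ y)
  have hs : s.SupportedOn (π ⁻¹' {π (h₁ y)}) := fun f hf => by
    change (f (h₁ y) + f (h₂ y)) / 2 = 0
    rw [hf _ rfl, hf _ (hover y).symm]; simp
  obtain ⟨z, hz⟩ := (isStronglyProximalOver_iff hπ.extension.continuous).1 hπ.stronglyProximal _ s hs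
  have hpair : Continuous fun y => (h₁ y, h₂ y) := hh₁.continuous.prodMk hh₂.continuous
  have hcl : IsClosed ((fun p : Z × Z => StateSpace.midpointEval p.1 p.2) ''
      range fun y => (h₁ y, h₂ y)) :=
    ((isCompact_range hpair).image StateSpace.continuous_midpointEval).isClosed
  have hsub : MulAction.orbit G s ⊆ (fun p : Z × Z => StateSpace.midpointEval p.1 p.2) ''
      range fun y => (h₁ y, h₂ y) := by
    rintro _ ⟨g, rfl⟩
    refine ⟨_, ⟨g • y, rfl⟩, ?_⟩
    simp only [hh₁.map_smul, hh₂.map_smul]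
    rfl
  obtain ⟨_, ⟨y', rfl⟩, hy'⟩ := closure_minimal hsub hcl hz
  obtain ⟨h1, h2⟩ := StateSpace.eq_of_midpointEval_eq_eval hy'
  have huniv : {y | h₁ y = h₂ y} = univ := MulAction.IsMinimal.eq_univ (G := G)
    (isClosed_eq hh₁.continuous hh₂.continuous) ⟨y', h1.trans h2.symm⟩ fun g y hy => by
      change h₁ (g • y) = h₂ (g • y)
      rw [hh₁.map_smul, hh₂.map_smul, show h₁ y = h₂ y from hy]
  exact funext fun y => huniv.ge (mem_univ y)

theorem IsGMap.comp {Y₁ : Type*} {Y₂ : Type*} {Y₃ : Type*} [TopologicalSpace Y₁]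
    [TopologicalSpace Y₂] [TopologicalSpace Y₃] [MulAction G Y₁] [MulAction G Y₂] [MulAction G Y₃]
    {g : Y₂ → Y₃} {f : Y₁ → Y₂} (hg : IsGMap G g) (hf : IsGMap G f) : IsGMap G (g ∘ f) :=
  ⟨hg.continuous.comp hf.continuous, fun γ y => by simp [hf.map_smul, hg.map_smul]⟩

theorem IsGMap.id {Y : Type*} [TopologicalSpace Y] [MulAction G Y] : IsGMap G (id : Y → Y) :=
  ⟨continuous_id, fun _ _ => rfl⟩

theorem IsUniversalBoundaryOver.exists_iso [T1Space X] [Nonempty X]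
    {Z₁ : Type v} [TopologicalSpace Z₁] [CompactSpace Z₁] [T2Space Z₁] [MulAction G Z₁]
    [ContinuousConstSMul G Z₁] {π₁ : Z₁ → X} (h₁ : IsUniversalBoundaryOver G π₁)
    {Z₂ : Type v} [TopologicalSpace Z₂] [CompactSpace Z₂] [T2Space Z₂] [MulAction G Z₂]
    [ContinuousConstSMul G Z₂] {π₂ : Z₂ → X} (h₂ : IsUniversalBoundaryOver G π₂) :
    ∃ e : Z₁ ≃ₜ Z₂, IsGIso G e ∧ ∀ z, π₂ (e z) = π₁ z := by
  obtain ⟨f, hf, hfπ⟩ := h₁.universal Z₂ π₂ h₂.boundary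
  obtain ⟨g, hg, hgπ⟩ := h₂.universal Z₁ π₁ h₁.boundary
  have := h₁.boundary.minimal
  have := h₂.boundary.minimal
  have : Nonempty Z₁ := h₁.boundary.extension.surjective.nonempty
  have : Nonempty Z₂ := h₂.boundary.extension.surjective.nonempty
  have hgf : g ∘ f = id := h₁.boundary.gMap_unique (hg.toIsGMap.comp hf.toIsGMap) IsGMap.id
    fun z => by simp [hgπ, hfπ]
  have hfg : f ∘ g = id := h₂.boundary.gMap_unique (hf.toIsGMap.comp hg.toIsGMap) IsGMap.id
    fun z => by simp [hgπ, hfπ]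
  exact ⟨⟨⟨f, g, congrFun hgf, congrFun hfg⟩, hf.continuous, hg.continuous⟩, hf.map_smul, hfπ⟩

end Rigidity

/-! ### Induced spaces -/

namespace InducedSpace

section Algebra

variable {Γ : Type u} [Group Γ] {Λ : Subgroup Γ} {T : Set Γ}
  {hT : Subgroup.IsComplement T (Λ : Set Γ)} {Y : Type v}

/-- The point `(q, y)` of the induced space. -/
def mk (q : Γ ⧸ Λ) (y : Y) : InducedSpace hT Y := (q, y)

/-- The projection `Γ/Λ × Y → Y`, which is not equivariant. -/
def snd (p : InducedSpace hT Y) : Y := p.2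

theorem cosetRep_smul (γ : Γ) (q : Γ ⧸ Λ) :
    γ * cosetRep hT q = cosetRep hT (γ • q) * (inducedCocycle hT γ q : Γ)⁻¹ := by
  simp only [inducedCocycle]; group

variable [MulAction Λ Y]

theorem smul_mk (γ : Γ) (q : Γ ⧸ Λ) (y : Y) :
    γ • (mk q y : InducedSpace hT Y) = mk (γ • q) ((inducedCocycle hT γ q)⁻¹ • y) := rfl

/-- The element `t' l t⁻¹`, for representatives `t`, `t'` of `q`, `q'`, carries the fibre over `q`
to the fibre over `q'` by `l`. -/
theorem conj_smul_mk (q q' : Γ ⧸ Λ) (l : Λ) (y : Y) :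
    (cosetRep hT q' * l * (cosetRep hT q)⁻¹) • (mk q y : InducedSpace hT Y) = mk q' (l • y) := by
  have hq : (cosetRep hT q' * l * (cosetRep hT q)⁻¹) • q = q' := by
    calc (cosetRep hT q' * l * (cosetRep hT q)⁻¹) • q
        = (cosetRep hT q' * l * (cosetRep hT q)⁻¹) • ((cosetRep hT q : Γ) : Γ ⧸ Λ) := by
          rw [mk_cosetRep]
      _ = ((cosetRep hT q' * l : Γ) : Γ ⧸ Λ) := by
          rw [MulAction.Quotient.smul_coe, smul_eq_mul, inv_mul_cancel_right]
      _ = q' := by rw [QuotientGroup.mk_mul_of_mem _ l.2, mk_cosetRep]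
  have hα : inducedCocycle hT (cosetRep hT q' * l * (cosetRep hT q)⁻¹) q = l⁻¹ := by
    apply Subtype.ext
    simp only [inducedCocycle, hq, Subgroup.coe_inv]
    group
  rw [smul_mk, hq, hα, inv_inv]

end Algebra

section Topological

variable {Γ : Type u} [Group Γ] [TopologicalSpace Γ] {Λ : Subgroup Γ} {T : Set Γ}
  {hT : Subgroup.IsComplement T (Λ : Set Γ)} {Y : Type v} [TopologicalSpace Y]

theorem continuous_toQuotient : Continuous (toQuotient : InducedSpace hT Y → Γ ⧸ Λ) :=
  continuous_fst

theorem continuous_snd : Continuous (snd : InducedSpace hT Y → Y) :=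
  _root_.continuous_snd

theorem continuous_mk (q : Γ ⧸ Λ) : Continuous (mk q : Y → InducedSpace hT Y) :=
  Continuous.prodMk_right q

theorem continuous_of_forall_mk [DiscreteTopology Γ] {Z : Type*} [TopologicalSpace Z]
    {f : InducedSpace hT Y → Z} (hf : ∀ q, Continuous fun y => f (mk q y)) : Continuous f :=
  have : DiscreteTopology (Γ ⧸ Λ) := QuotientGroup.discreteTopology (isOpen_discrete _)
  continuous_prod_of_discrete_left.2 hf

variable [MulAction Λ Y]

theorem isMinimal [MulAction.IsMinimal Λ Y] : MulAction.IsMinimal Γ (InducedSpace hT Y) where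
  dense_orbit := by
    rintro ⟨q, y⟩
    refine dense_iff_inter_open.2 ?_
    rintro U hU ⟨⟨q', y'⟩, hy'⟩
    obtain ⟨l, hl⟩ := (hU.preimage (continuous_mk q')).exists_smul_mem Λ y ⟨y', hy'⟩
    exact ⟨_, hl, _, conj_smul_mk q q' l y⟩

variable [DiscreteTopology Γ]

/-- Induction is functorial. -/
theorem isExtension_map {Z : Type w} [TopologicalSpace Z] [MulAction Λ Z] {f : Y → Z}
    (hf : IsExtension Λ f) :
    IsExtension Γ fun p : InducedSpace hT Y => (mk p.toQuotient (f p.snd) : InducedSpace hT Z) where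
  continuous := continuous_of_forall_mk fun q => (continuous_mk q).comp hf.continuous
  map_smul γ p := by
    change mk _ (f ((inducedCocycle hT γ p.1)⁻¹ • p.2)) = _
    rw [hf.map_smul]
    rfl
  surjective := by
    rintro ⟨q, z⟩
    obtain ⟨y, rfl⟩ := hf.surjective z
    exact ⟨mk q y, rfl⟩

variable [ContinuousConstSMul Λ Y]

/-- A state supported on the fibre over `q` is a state on `Y`, on which the stabilizer of `q`, a
conjugate of `Λ`, acts as `Λ` does. -/
theorem isStronglyProximalOver [CompactSpace Y] [T2Space Y] [Λ.FiniteIndex]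
    (hY : IsStronglyProximal Λ Y) :
    IsStronglyProximalOver Γ (toQuotient : InducedSpace hT Y → Γ ⧸ Λ) := by
  have : DiscreteTopology (Γ ⧸ Λ) := QuotientGroup.discreteTopology (isOpen_discrete _)
  rw [isStronglyProximalOver_iff (continuous_toQuotient (hT := hT))]
  intro q s hs
  let j : C(Y, InducedSpace hT Y) := ⟨mk q, continuous_mk q⟩
  let p : C(InducedSpace hT Y, Y) := ⟨snd, continuous_snd⟩
  obtain ⟨y, hy⟩ := isStronglyProximal_iff.1 hY (s.map p)
  have hjs : (s.map p).map j = s := StateSpace.ext fun f => hs.congr fun z hz => by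
    change f (mk q z.2) = f z
    rw [← show z.1 = q from hz]
    rfl
  refine ⟨j y, ?_⟩
  have h1 := image_closure_subset_closure_image (StateSpace.continuous_map j)
    (mem_image_of_mem _ hy)
  refine closure_mono ?_ h1
  rintro _ ⟨_, ⟨l, rfl⟩, rfl⟩
  refine ⟨cosetRep hT q * l * (cosetRep hT q)⁻¹, ?_⟩
  change (cosetRep hT q * l * (cosetRep hT q)⁻¹) • s = _
  conv_lhs => rw [← hjs]
  refine StateSpace.ext fun f => congrArg (s.map p) (ContinuousMap.ext fun y => ?_)
  exact congrArg f (conj_smul_mk q q l y)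

theorem isBoundaryOver [CompactSpace Y] [T2Space Y] [Λ.FiniteIndex] (hY : IsBoundary Λ Y) :
    IsBoundaryOver Γ (toQuotient : InducedSpace hT Y → Γ ⧸ Λ) where
  extension := ⟨⟨continuous_toQuotient, fun _ _ => rfl⟩,
    fun q => ⟨mk q hY.nonempty.some, rfl⟩⟩
  minimal := have := hY.minimal; isMinimal
  stronglyProximal := isStronglyProximalOver hY.stronglyProximal

end Topological

end InducedSpace

theorem IsExtension.comp {G : Type u} [Group G] {Y₁ : Type*} {Y₂ : Type*} {Y₃ : Type*}
    [TopologicalSpace Y₁] [TopologicalSpace Y₂] [TopologicalSpace Y₃] [MulAction G Y₁]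
    [MulAction G Y₂] [MulAction G Y₃] {g : Y₂ → Y₃} {f : Y₁ → Y₂} (hg : IsExtension G g)
    (hf : IsExtension G f) : IsExtension G (g ∘ f) :=
  ⟨hg.toIsGMap.comp hf.toIsGMap, hg.surjective.comp hf.surjective⟩

theorem IsBoundaryOver.comp_equiv {G : Type u} [Group G] {Y : Type v} [TopologicalSpace Y]
    [CompactSpace Y] [T2Space Y] [MulAction G Y] [ContinuousConstSMul G Y] {X : Type*}
    [TopologicalSpace X] [MulAction G X] {X' : Type*} [TopologicalSpace X'] [MulAction G X']
    {φ : Y → X} (hφ : IsBoundaryOver G φ) {f : X → X'} (hf : IsExtension G f)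
    (hinj : Function.Injective f) : IsBoundaryOver G (f ∘ φ) where
  extension := hf.comp hφ.extension
  minimal := hφ.minimal
  stronglyProximal ν hν x' hx' := by
    obtain ⟨x, rfl⟩ := hf.surjective x'
    exact hφ.stronglyProximal ν hν x (hx'.trans fun y hy => hinj hy)

theorem ofQuotientStabilizer_cosetRep {Γ : Type u} [Group Γ] {X : Type v} [MulAction Γ X] {x : X}
    {T : Set Γ}
    (hT : Subgroup.IsComplement T (MulAction.stabilizer Γ x : Set Γ))
    (q : Γ ⧸ MulAction.stabilizer Γ x) :
    MulAction.ofQuotientStabilizer Γ x q = cosetRep hT q • x := by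
  conv_lhs => rw [← mk_cosetRep hT q]
  rfl

theorem ofQuotientStabilizer_bijective {Γ : Type u} [Group Γ] {X : Type v} [MulAction Γ X] {x : X}
    [MulAction.IsPretransitive Γ X] :
    Function.Bijective (MulAction.ofQuotientStabilizer Γ x) :=
  ⟨MulAction.injective_ofQuotientStabilizer Γ x, fun z =>
    let ⟨g, hg⟩ := MulAction.exists_smul_eq Γ x z; ⟨(g : Γ ⧸ MulAction.stabilizer Γ x), hg⟩⟩

theorem finiteIndex_stabilizer_of_finite {Γ : Type u} [Group Γ] {X : Type v}
    [MulAction Γ X] [Finite X] (x : X) :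
    (MulAction.stabilizer Γ x).FiniteIndex :=
  have := Finite.of_injective _ (MulAction.injective_ofQuotientStabilizer Γ x)
  Subgroup.finiteIndex_of_finite_quotient

/-! ### Fibres over a finite minimal space -/

section Fibre

variable {Γ : Type u} [Group Γ] {X : Type v} [TopologicalSpace X] [MulAction Γ X]
  {Y : Type w} [TopologicalSpace Y] [MulAction Γ Y]

/-- The fibre over `x` of an equivariant map, as a space with an action of the stabilizer of `x`. -/
def fibre {φ : Y → X} (hφ : IsGMap Γ φ) (x : X) : SubMulAction (MulAction.stabilizer Γ x) Y where
  carrier := φ ⁻¹' {x}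
  smul_mem' g y hy := by
    change φ ((g : Γ) • y) = x
    rw [hφ.map_smul, show φ y = x from hy]
    exact g.2

variable {φ : Y → X} {hφ : IsGMap Γ φ} {x : X}

theorem mem_fibre {y : Y} : y ∈ fibre hφ x ↔ φ y = x := Iff.rfl

theorem mem_stabilizer_of_smul_mem_fibre {y : Y} (hy : y ∈ fibre hφ x) {g : Γ}
    (hg : g • y ∈ fibre hφ x) : g ∈ MulAction.stabilizer Γ x := by
  rw [mem_fibre] at hy hg
  rwa [hφ.map_smul, hy] at hg

instance [ContinuousConstSMul Γ Y] :
    ContinuousConstSMul (MulAction.stabilizer Γ x) (fibre hφ x) where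
  continuous_const_smul g :=
    ((continuous_const_smul (g : Γ)).comp continuous_subtype_val).subtype_mk _

theorem isClosed_fibre [T1Space X] : IsClosed (fibre hφ x : Set Y) :=
  isClosed_singleton.preimage hφ.continuous

theorem isOpen_fibre [DiscreteTopology X] : IsOpen (fibre hφ x : Set Y) :=
  (isOpen_discrete {x}).preimage hφ.continuous

instance [T1Space X] [CompactSpace Y] : CompactSpace (fibre hφ x) :=
  isCompact_iff_compactSpace.1 (isClosed_fibre (hφ := hφ) (x := x)).isCompact

theorem isMinimal_fibre [DiscreteTopology X] [MulAction.IsMinimal Γ Y] :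
    MulAction.IsMinimal (MulAction.stabilizer Γ x) (fibre hφ x) where
  dense_orbit y := by
    refine dense_iff_inter_open.2 ?_
    rintro U hU ⟨z, hz⟩
    obtain ⟨g, z', hz', hg⟩ := ((isOpen_fibre (hφ := hφ)).isOpenMap_subtype_val U hU).exists_smul_mem
      Γ (y : Y) ⟨z, z, hz, rfl⟩
    exact ⟨z', hz', ⟨g, mem_stabilizer_of_smul_mem_fibre y.2 (hg ▸ z'.2)⟩, Subtype.ext hg.symm⟩

/-- A state on the fibre is contracted by `Γ` to a point mass, which may be moved into the fibre.
The elements of `Γ` that nearly accomplish this leave mass in the clopen fibre, so they belong to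
the stabilizer. -/
theorem isStronglyProximal_fibre [DiscreteTopology X] [CompactSpace Y] [T2Space Y]
    [ContinuousConstSMul Γ Y] [MulAction.IsPretransitive Γ X] (h : IsStronglyProximalOver Γ φ) :
    IsStronglyProximal (MulAction.stabilizer Γ x) (fibre hφ x) := by
  refine isStronglyProximal_iff.2 fun s => ?_
  let i : C(fibre hφ x, Y) := ⟨Subtype.val, continuous_subtype_val⟩
  have hsupp : (s.map i).SupportedOn (φ ⁻¹' {x}) := fun f hf => by
    have : f.comp i = 0 := ContinuousMap.ext fun y => hf y y.2
    rw [StateSpace.map_apply, this, s.map_zero]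
  obtain ⟨y, hy⟩ := (isStronglyProximalOver_iff hφ.continuous).1 h x _ hsupp
  obtain ⟨g, hg⟩ := MulAction.exists_smul_eq Γ (φ y) x
  have hgy : g • y ∈ fibre hφ x := (hφ.map_smul g y).trans hg
  have hcl := closure_orbit_smul_mem _ g _ hy
  -- the indicator function of the fibre
  let χ : C(Y, ℝ) := ⟨(fibre hφ x : Set Y).indicator 1,
    (IsClopen.continuous_indicator ⟨isClosed_fibre, isOpen_fibre⟩ continuous_one)⟩
  have hU : IsOpen {t : StateSpace Y | 0 < t χ} :=
    isOpen_lt continuous_const (StateSpace.continuous_apply χ)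
  have hgU : StateSpace.eval (g • y) ∈ {t : StateSpace Y | 0 < t χ} := by
    have h1 : (fibre hφ x : Set Y).indicator (1 : Y → ℝ) (g • y) = 1 := indicator_of_mem hgy _
    exact one_pos.trans_eq h1.symm
  have hsub : {t : StateSpace Y | 0 < t χ} ∩ MulAction.orbit Γ (s.map i) ⊆
      StateSpace.map i '' MulAction.orbit (MulAction.stabilizer Γ x) s := by
    rintro _ ⟨hpos, k, rfl⟩
    have hk : k ∈ MulAction.stabilizer Γ x := by
      by_contra hk
      have : (χ.comp (StateSpace.translation Y k)).comp i = 0 := ContinuousMap.ext fun z =>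
        indicator_of_notMem (fun hkz => hk (mem_stabilizer_of_smul_mem_fibre z.2 hkz)) _
      have h0 : (k • s.map i) χ = 0 := by
        rw [StateSpace.smul_apply, StateSpace.map_apply, this, s.map_zero]
      exact hpos.ne' h0
    exact ⟨_, ⟨⟨k, hk⟩, rfl⟩, rfl⟩
  have hmem := closure_mono hsub (hU.inter_closure ⟨hgU, hcl⟩)
  have hK : IsClosed (StateSpace.map i '' closure (MulAction.orbit (MulAction.stabilizer Γ x) s)) :=
    (isClosed_closure.isCompact.image (StateSpace.continuous_map i)).isClosed
  obtain ⟨t, ht, hteq⟩ := closure_minimal (image_mono subset_closure) hK hmem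
  refine ⟨⟨g • y, hgy⟩, ?_⟩
  convert ht
  refine StateSpace.ext fun f => ?_
  -- push-forward along the inclusion is injective on states, by Tietze's theorem
  obtain ⟨F, hF⟩ := f.exists_extension
    (isClosed_fibre (hφ := hφ) (x := x)).isClosedEmbedding_subtypeVal
  have hFi : F.comp i = f := hF
  rw [← hFi]
  exact (DFunLike.congr_fun hteq F).symm

theorem IsBoundaryOver.isBoundary_fibre [DiscreteTopology X] [CompactSpace Y] [T2Space Y]
    [ContinuousConstSMul Γ Y] [MulAction.IsPretransitive Γ X] (h : IsBoundaryOver Γ φ) :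
    IsBoundary (MulAction.stabilizer Γ x) (fibre hφ x) where
  nonempty := let ⟨y, hy⟩ := h.extension.surjective x; ⟨⟨y, hy⟩⟩
  minimal := have := h.minimal; isMinimal_fibre
  stronglyProximal := isStronglyProximal_fibre h.stronglyProximal

/-- A space over a transitive discrete space is induced from any of its fibres, by
`(q, y) ↦ t y` for the representative `t` of `q`. -/
theorem exists_inducedSpace_fibre_iso [TopologicalSpace Γ] [DiscreteTopology Γ] [T2Space X]
    [MulAction.IsPretransitive Γ X] [CompactSpace Y] [T2Space Y] [ContinuousConstSMul Γ Y]
    [(MulAction.stabilizer Γ x).FiniteIndex] {T : Set Γ}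
    (hT : Subgroup.IsComplement T (MulAction.stabilizer Γ x : Set Γ)) :
    ∃ e : InducedSpace hT (fibre hφ x) ≃ₜ Y, IsGIso Γ e ∧
      ∀ p, φ (e p) = MulAction.ofQuotientStabilizer Γ x p.toQuotient := by
  let f : InducedSpace hT (fibre hφ x) → Y := fun p => cosetRep hT p.toQuotient • (p.snd : Y)
  have hfφ : ∀ p, φ (f p) = MulAction.ofQuotientStabilizer Γ x p.toQuotient := fun p => by
    rw [hφ.map_smul, mem_fibre.1 p.snd.2, ofQuotientStabilizer_cosetRep hT]
  have hcont : Continuous f := InducedSpace.continuous_of_forall_mk fun q =>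
    (continuous_const_smul (cosetRep hT q)).comp continuous_subtype_val
  have hbij : Function.Bijective f := by
    constructor
    · rintro ⟨q, y⟩ ⟨q', y'⟩ h
      have hq : q = q' := (ofQuotientStabilizer_bijective (Γ := Γ) (x := x)).1
        (((hfφ (q, y)).symm.trans (congrArg φ h)).trans (hfφ (q', y')))
      subst hq
      have hy : y = y' := Subtype.ext (MulAction.injective (cosetRep hT q) h)
      rw [hy]
    · intro y
      obtain ⟨q, hq⟩ := (ofQuotientStabilizer_bijective (Γ := Γ) (x := x)).2 (φ y)
      have hy : (cosetRep hT q)⁻¹ • y ∈ fibre hφ x := by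
        rw [mem_fibre, hφ.map_smul, ← hq, ofQuotientStabilizer_cosetRep hT, inv_smul_smul]
      exact ⟨InducedSpace.mk q ⟨_, hy⟩, smul_inv_smul (cosetRep hT q) y⟩
  refine ⟨Continuous.homeoOfEquivCompactToT2 (f := Equiv.ofBijective f hbij) hcont, ?_, hfφ⟩
  rintro γ ⟨q, y⟩
  change cosetRep hT (γ • q) • (((inducedCocycle hT γ q)⁻¹ : MulAction.stabilizer Γ x) : Γ) • (y : Y) =
    γ • cosetRep hT q • (y : Y)
  rw [smul_smul, smul_smul, InducedSpace.cosetRep_smul, Subgroup.coe_inv]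

end Fibre

section FiniteMinimal

variable {Γ : Type u} [Group Γ] {X : Type v} [TopologicalSpace X] [T2Space X] [Finite X]
  [MulAction Γ X] [MulAction.IsMinimal Γ X]

theorem MulAction.IsMinimal.isPretransitive_of_finite (Γ : Type u) [Group Γ] (X : Type v)
    [TopologicalSpace X] [T1Space X] [Finite X] [MulAction Γ X] [MulAction.IsMinimal Γ X] :
    MulAction.IsPretransitive Γ X where
  exists_smul_eq x y := (isOpen_discrete {y}).exists_smul_mem Γ x ⟨y, rfl⟩

/-- The space induced from the Furstenberg boundary of a point stabilizer is a universal boundary: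
a boundary over `X` is induced from its fibre, which is an image of the Furstenberg boundary. -/
theorem isUniversalBoundaryOver_inducedSpace [TopologicalSpace Γ] [DiscreteTopology Γ] (x : X)
    [(MulAction.stabilizer Γ x).FiniteIndex]
    {T : Set Γ} (hT : Subgroup.IsComplement T (MulAction.stabilizer Γ x : Set Γ))
    {F : Type u} [TopologicalSpace F] [CompactSpace F] [T2Space F]
    [MulAction (MulAction.stabilizer Γ x) F] [ContinuousConstSMul (MulAction.stabilizer Γ x) F]
    (hF : IsFurstenbergBoundary (MulAction.stabilizer Γ x) F) :
    IsUniversalBoundaryOver Γ fun p : InducedSpace hT F =>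
      MulAction.ofQuotientStabilizer Γ x p.toQuotient where
  boundary := by
    have := MulAction.IsMinimal.isPretransitive_of_finite Γ X
    have : DiscreteTopology (Γ ⧸ MulAction.stabilizer Γ x) :=
      QuotientGroup.discreteTopology (isOpen_discrete _)
    exact (InducedSpace.isBoundaryOver hF.boundary).comp_equiv
      ⟨⟨continuous_of_discreteTopology, fun g q => MulAction.ofQuotientStabilizer_smul Γ x g q⟩,
        ofQuotientStabilizer_bijective.2⟩ ofQuotientStabilizer_bijective.1
  universal Y _ _ _ _ _ φ hφ := by
    have := MulAction.IsMinimal.isPretransitive_of_finite Γ X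
    obtain ⟨f, hf⟩ := hF.universal (fibre hφ.extension.toIsGMap x) hφ.isBoundary_fibre
    obtain ⟨e, he, heφ⟩ := exists_inducedSpace_fibre_iso (hφ := hφ.extension.toIsGMap) hT
    have heext : IsExtension Γ e := ⟨⟨e.continuous, he⟩, e.surjective⟩
    exact ⟨_, heext.comp (InducedSpace.isExtension_map hf), fun z => heφ _⟩

end FiniteMinimal

/-! ### Induction and restriction over finite minimal spaces -/

theorem theoremB {Γ : Type u} [Group Γ] [Countable Γ] [TopologicalSpace Γ] [DiscreteTopology Γ] :
    -- the induced space of a `Λ`-boundary is a `(Γ, Γ/Λ)`-boundary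
    (∀ (Λ : Subgroup Γ) [Λ.FiniteIndex] (T : Set Γ)
      (hT : Subgroup.IsComplement T (Λ : Set Γ))
      (Y : Type v) [TopologicalSpace Y] [CompactSpace Y] [T2Space Y]
      [MulAction Λ Y] [ContinuousConstSMul Λ Y],
      IsBoundary Λ Y →
        IsBoundaryOver Γ (InducedSpace.toQuotient : InducedSpace hT Y → Γ ⧸ Λ)) ∧
    -- every boundary over a finite minimal space is induced from a point stabilizer
    (∀ (X : Type v) [TopologicalSpace X] [T2Space X] [Finite X] [Nonempty X]
      [MulAction Γ X] [ContinuousConstSMul Γ X] [MulAction.IsMinimal Γ X]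
      (Y : Type w) [TopologicalSpace Y] [CompactSpace Y] [T2Space Y]
      [MulAction Γ Y] [ContinuousConstSMul Γ Y] (φ : Y → X),
      IsBoundaryOver Γ φ → ∀ x : X,
        (MulAction.stabilizer Γ x).FiniteIndex ∧
        ∃ (B : Type w) (_ : TopologicalSpace B) (_ : CompactSpace B) (_ : T2Space B)
          (_ : MulAction (MulAction.stabilizer Γ x) B)
          (_ : ContinuousConstSMul (MulAction.stabilizer Γ x) B),
          IsBoundary (MulAction.stabilizer Γ x) B ∧
          ∀ (T : Set Γ) (hT : Subgroup.IsComplement T (MulAction.stabilizer Γ x : Set Γ)),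
            ∃ e : InducedSpace hT B ≃ₜ Y, IsGIso Γ e ∧
              ∀ p, φ (e p) = MulAction.ofQuotientStabilizer Γ x p.toQuotient) ∧
    -- the universal boundary over a finite minimal space is induced from the Furstenberg boundary
    (∀ (X : Type v) [TopologicalSpace X] [T2Space X] [Finite X] [Nonempty X]
      [MulAction Γ X] [ContinuousConstSMul Γ X] [MulAction.IsMinimal Γ X],
      (∃ (Z : Type u) (_ : TopologicalSpace Z) (_ : CompactSpace Z) (_ : T2Space Z)
        (_ : MulAction Γ Z) (_ : ContinuousConstSMul Γ Z) (π : Z → X),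
        IsUniversalBoundaryOver Γ π) ∧
      ∀ x : X,
        (MulAction.stabilizer Γ x).FiniteIndex ∧
        (∃ (F : Type u) (_ : TopologicalSpace F) (_ : CompactSpace F) (_ : T2Space F)
          (_ : MulAction (MulAction.stabilizer Γ x) F)
          (_ : ContinuousConstSMul (MulAction.stabilizer Γ x) F),
          IsFurstenbergBoundary (MulAction.stabilizer Γ x) F) ∧
        ∀ (Z : Type u) [TopologicalSpace Z] [CompactSpace Z] [T2Space Z]
          [MulAction Γ Z] [ContinuousConstSMul Γ Z] (π : Z → X)
          (F : Type u) [TopologicalSpace F] [CompactSpace F] [T2Space F]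
          [MulAction (MulAction.stabilizer Γ x) F]
          [ContinuousConstSMul (MulAction.stabilizer Γ x) F],
          IsUniversalBoundaryOver Γ π →
          IsFurstenbergBoundary (MulAction.stabilizer Γ x) F →
          ∀ (T : Set Γ) (hT : Subgroup.IsComplement T (MulAction.stabilizer Γ x : Set Γ)),
            ∃ e : InducedSpace hT F ≃ₜ Z, IsGIso Γ e ∧
              ∀ p, π (e p) = MulAction.ofQuotientStabilizer Γ x p.toQuotient) := by
  refine ⟨fun Λ _ T hT Y _ _ _ _ _ hY => InducedSpace.isBoundaryOver hY, ?_, ?_⟩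
  · intro X _ _ _ _ _ _ _ Y _ _ _ _ _ φ hφ x
    have := MulAction.IsMinimal.isPretransitive_of_finite Γ X
    have hfin := finiteIndex_stabilizer_of_finite (Γ := Γ) x
    exact ⟨hfin, fibre hφ.extension.toIsGMap x, _, inferInstance, inferInstance, _, inferInstance,
      hφ.isBoundary_fibre, fun T hT => exists_inducedSpace_fibre_iso hT⟩
  · intro X _ _ _ _ _ _ _
    have hfin := finiteIndex_stabilizer_of_finite (Γ := Γ) (X := X)
    refine ⟨?_, fun x => ⟨hfin x, exists_isFurstenbergBoundary _, ?_⟩⟩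
    · obtain ⟨x⟩ := ‹Nonempty X›
      obtain ⟨T, hT, -⟩ := (MulAction.stabilizer Γ x).exists_isComplement_left 1
      obtain ⟨F, _, _, _, _, _, hF⟩ := exists_isFurstenbergBoundary (MulAction.stabilizer Γ x)
      exact ⟨InducedSpace hT F, _, inferInstance, inferInstance, _, inferInstance, _,
        isUniversalBoundaryOver_inducedSpace x hT hF⟩
    · intro Z _ _ _ _ _ π F _ _ _ _ _ hZ hF T hT
      exact (isUniversalBoundaryOver_inducedSpace x hT hF).exists_iso hZ
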